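/- **Setting.** Consider $x_{k+1}=Ax_k+w_k$, $y_k=Cx_k+v_k$ with $x_k\in\mathbb R^n$ and independent zero-mean Gaussian noises of covariances $Q,R\ge 0$, with $(C,A)$ observable and $(A,\sqrt Q)$ controllable. Let $\bar P$ be the steady-state value of the posterior error covariance of the sensor's Kalman filter, $f(X)=AXA^\top+Q$, and let $|\lambda_{\max}(A)|$ be the largest modulus of an eigenvalue of $A$. Let $\nu_k\in\{0,1\}$ be the transmission command of the sensor. A transmission is received by the legitimate estimator with probability $\lambda$ ($\gamma_k=1$) and, independently, by the adversary with probability $\lambda_e$ ($\gamma^e_k=1$); a reception at the legitimate estimator is acknowledged to the sensor, and the acknowledgment arrives with probability $\lambda_a$ ($\gamma_k^a=1$). The holding times $\eta_k,\eta_k^s,\eta_k^e\in\mathbb N$ of the legitimate estimator, the sensor and the adversary are reset to $0$ at time $k$ if $\nu_k\gamma_k=1$, if $\nu_k\gamma_k\gamma^a_k=1$ and if $\nu_k\gamma_k^e=1$, respectively, and otherwise increase by $1$. The error covariances are $P_k=f^{\eta_k}(\bar P)$ at the legitimate estimator and $P_k^e=f^{\eta_k^e}(\bar P)$ at the adversary,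 and $$J_l=\lim_{T\to\infty}\frac1T\sum_{k=1}^T \mathrm{tr}\,\mathbb E(P_k),\qquad J_e=\lim_{T\to\infty}\frac1T\sum_{k=1}^T \mathrm{tr}\,\mathbb E(P^e_k).$$ A reference policy has the form $\mathbb P(\nu_{k+1}=1\mid\eta_k^s=i)=\tau_i$; a malicious policy, used by the hacked sensor, has the form $\mathbb P(\nu_{k+1}=1\mid\eta_k^s=i,\eta_k^e=j)=\tilde\tau_{ij}$, with arbitrary $\tilde\tau_{ij}\in[0,1]$. For a detection horizon $N_r\in\mathbb N$ let $\mathcal P_0$ and $\mathcal P_1$ be the steady-state (long-run) marginal distributions of $o_{k+1:k+N_r}=(\nu_{k+1}\gamma_{k+1},\dots,\nu_{k+N_r}\gamma_{k+N_r})$ under the reference policy and under the malicious policy, that is, the limits as $T\to\infty$ of the averages over $0\le k<T$ of the laws of $o_{k+1:k+N_r}$; for a chain started in a stationary law this is the law of $o_{k+1:k+N_r}$ itself. The stealthy constraint with tolerance $\epsilon_{kl}>0$ is $\mathcal{KL}(\mathcal P_1\|\mathcal P_0)\le\epsilon_{kl}$, where $\mathcal{KL}(\mathcal P_1\|\mathcal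 P_0)=\infty$ if $\mathcal P_1$ is not absolutely continuous with respect to $\mathcal P_0$. **Theorem (attainability of perfect secrecy).** Assume $\lambda_a=1$, $0<\lambda_e<1$ and $|\lambda_{\max}(A)|>1$. Let $\bar t\in\mathbb N$ satisfy $$\frac1{|\lambda_{\max}(A)|^{2(\bar t+1)}}<\lambda(1-\lambda_e),$$ and let the reference policy be to transmit at time $k+1$ if and only if $\eta_k^s>\bar t$. 1. If $N_r>\bar t$, then for every $\epsilon_{kl}>0$ and every initial law of the holding times, no malicious policy $(\tilde\tau_{ij})$ can simultaneously keep $J_e$ bounded and satisfy the stealthy constraint. (Here $J_e$ bounded is read in the weakest sense, as finiteness of the limit inferior of the averages that define $J_e$.) 2. If moreover $\lambda>1-1/|\lambda_{\max}(A)|^2$, then, without an intrusion, the reference policy keeps $J_l$ bounded (the limit superior of the averages that define $J_l$ is finite) for every initial law of the holding times with $\mathrm{tr}\,\mathbb E(P_0)<\infty$. Hence, when $\lambda>1-1/|\lambda_{\max}(A)|^2$, perfect secrecy ($J_l$ bounded under the reference policy, $J_e$ unbounded under every stealthy malicious policy) is attained. -/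

import Mathlib

open Filter Topology unitInterval
open scoped ENNReal

noncomputable section

namespace RemoteEstimation

/-! ### The linear system and the sensor's Kalman filter -/

section System

variable {n p q : ℕ}

/-- `|λ_max(A)|`: the largest modulus of a complex eigenvalue of the real matrix `A`. -/
def maxEig (A : Matrix (Fin n) (Fin n) ℝ) : ℝ :=
  (spectralRadius ℂ (A.map (algebraMap ℝ ℂ))).toReal

/-- The pair `(A, B)` is controllable: the ranges of `B, AB, …, A^{n-1}B` span the state space. -/
def Controllable (A : Matrix (Fin n) (Fin n) ℝ) (B : Matrix (Fin n) (Fin q) ℝ) : Prop :=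
  (⨆ k : Fin n, LinearMap.range (A ^ (k : ℕ) * B).mulVecLin) = ⊤

/-- The pair `(C, A)` is observable: the kernels of `C, CA, …, CA^{n-1}` meet only in `0`. -/
def Observable (C : Matrix (Fin p) (Fin n) ℝ) (A : Matrix (Fin n) (Fin n) ℝ) : Prop :=
  (⨅ k : Fin n, LinearMap.ker (C * A ^ (k : ℕ)).mulVecLin) = ⊥

/-- The prediction map `f(X) = A X Aᵀ + Q`. -/
def predict (A Q X : Matrix (Fin n) (Fin n) ℝ) : Matrix (Fin n) (Fin n) ℝ :=
  A * X * A.transpose + Q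

/-- `P` is the posterior error covariance that the Kalman filter obtains from the prior error
covariance `M` with a measurement `y = C x + v`, `Cov v = R`. The gain `K` solves
`K (C M Cᵀ + R) = M Cᵀ`, so `K = M Cᵀ (C M Cᵀ + R)⁻¹` whenever `C M Cᵀ + R` is invertible; when it
is singular, `K` need not be unique, but `M - K C M` does not depend on the choice of `K`. -/
def IsKalmanUpdate (C : Matrix (Fin p) (Fin n) ℝ) (R : Matrix (Fin p) (Fin p) ℝ)
    (M P : Matrix (Fin n) (Fin n) ℝ) : Prop :=
  ∃ K : Matrix (Fin n) (Fin p) ℝ,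
    K * (C * M * C.transpose + R) = M * C.transpose ∧ P = M - K * C * M

/-- `Pbar` is the steady-state value of the posterior error covariance `P_k^s` of the sensor's
Kalman filter, started from some prior covariance `M₀` of the initial state `x_0`. -/
def IsSteadyStateCov (A : Matrix (Fin n) (Fin n) ℝ) (C : Matrix (Fin p) (Fin n) ℝ)
    (Q : Matrix (Fin n) (Fin n) ℝ) (R : Matrix (Fin p) (Fin p) ℝ)
    (Pbar : Matrix (Fin n) (Fin n) ℝ) : Prop :=
  ∃ (M₀ : Matrix (Fin n) (Fin n) ℝ) (P : ℕ → Matrix (Fin n) (Fin n) ℝ),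
    M₀.PosSemidef ∧ IsKalmanUpdate C R M₀ (P 0) ∧
      (∀ k, IsKalmanUpdate C R (predict A Q (P k)) (P (k + 1))) ∧ Tendsto P atTop (𝓝 Pbar)

/-- `tr f^h(P̄)`: the trace of the error covariance of an estimator whose last successful reception
was `h` time steps ago. -/
def errTrace (A Q Pbar : Matrix (Fin n) (Fin n) ℝ) (h : ℕ) : ℝ :=
  ((predict A Q)^[h] Pbar).trace

end System

/-! ### Transmissions over the packet-dropping channels -/

/-- The reception probabilities: `lam` at the legitimate estimator, `lamA` for the acknowledgment
sent back to the sensor, `lamE` at the adversary. -/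
structure Channel where
  lam : I
  lamA : I
  lamE : I

/-- The holding times: `eta` at the legitimate estimator, `etaS` at the sensor (the time since the
last acknowledgment it received), `etaE` at the adversary. -/
@[ext] structure HoldingTimes where
  eta : ℕ
  etaS : ℕ
  etaE : ℕ

/-- A coin that shows `true` with probability `p`. -/
def coin (p : I) : PMF Bool :=
  PMF.ofFintype (fun b => if b then ENNReal.ofReal (p : ℝ) else ENNReal.ofReal (1 - (p : ℝ))) (by
    have h0 : (0 : ℝ) ≤ (p : ℝ) := p.2.1
    have h1 : (0 : ℝ) ≤ 1 - (p : ℝ) := sub_nonneg.2 p.2.2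
    simp [← ENNReal.ofReal_add h0 h1])

/-- A transmission policy at the (possibly hacked) sensor: `pol i j` is the probability of
`ν_{k+1} = 1` given `η_k^s = i` and `η_k^e = j`. -/
abbrev Policy := ℕ → ℕ → I

/-- The reference policy with threshold `t`: transmit if and only if `η_k^s > t`. -/
def thresholdPolicy (t : ℕ) : Policy := fun i _ => if t < i then 1 else 0

/-- One time step from the holding times `s` at time `k`: the joint law of the observation
`o_{k+1} = ν_{k+1} γ_{k+1}` of the legitimate estimator and of the holding times at time `k+1`.
Here `nu` is the transmission command, `g`, `a`, `e` decide about the reception of the packet at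
the legitimate estimator, of the acknowledgment (sent only if the packet was received) at the
sensor, and of the packet at the adversary. -/
def step (ch : Channel) (pol : Policy) (s : HoldingTimes) : PMF (Bool × HoldingTimes) :=
  (coin (pol s.etaS s.etaE)).bind fun nu =>
  (coin ch.lam).bind fun g =>
  (coin ch.lamA).bind fun a =>
  (coin ch.lamE).bind fun e =>
  PMF.pure (nu && g,
    { eta := if nu && g then 0 else s.eta + 1
      etaS := if nu && g && a then 0 else s.etaS + 1
      etaE := if nu && e then 0 else s.etaE + 1 })

/-- The law of the holding times at time `k`, when their law at time `0` is `init`. -/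
def stateLaw (ch : Channel) (pol : Policy) (init : PMF HoldingTimes) : ℕ → PMF HoldingTimes
  | 0 => init
  | k + 1 => (stateLaw ch pol init k).bind fun s => (step ch pol s).map Prod.snd

/-- The law of the next `N` observations when the current holding times are `s`. -/
def windowLaw (ch : Channel) (pol : Policy) : (N : ℕ) → HoldingTimes → PMF (Fin N → Bool)
  | 0, _ => PMF.pure Fin.elim0
  | N + 1, s => (step ch pol s).bind fun x =>
      (windowLaw ch pol N x.2).map fun w => (Fin.cons x.1 w : Fin (N + 1) → Bool)

/-- The law of `o_{k+1:k+N} = (ν_{k+1} γ_{k+1}, …, ν_{k+N} γ_{k+N})`. -/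
def obsLaw (ch : Channel) (pol : Policy) (init : PMF HoldingTimes) (N k : ℕ) :
    PMF (Fin N → Bool) :=
  (stateLaw ch pol init k).bind (windowLaw ch pol N)

/-- `P` is the steady-state (long-run) marginal distribution of `N` consecutive observations:
the limit of the time averages of the laws of `o_{k+1:k+N}`. When the holding times start from a
stationary distribution, `o_{k+1:k+N}` has the law `P` for every `k`. -/
def IsLongRunObsLaw (ch : Channel) (pol : Policy) (init : PMF HoldingTimes) (N : ℕ)
    (P : PMF (Fin N → Bool)) : Prop :=
  ∀ w, Tendsto (fun T : ℕ => (∑ k ∈ Finset.range T, obsLaw ch pol init N k w) / (T : ℝ≥0∞))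
    atTop (𝓝 (P w))

/-- The finite-horizon average `(1/T) ∑_{k=1}^T tr E(P_k)`, where `P_k = f^{h(s_k)}(P̄)` and `h` is
`HoldingTimes.eta` for the legitimate estimator, `HoldingTimes.etaE` for the adversary. -/
def avgErr {n : ℕ} (A Q Pbar : Matrix (Fin n) (Fin n) ℝ) (ch : Channel) (pol : Policy)
    (init : PMF HoldingTimes) (h : HoldingTimes → ℕ) (T : ℕ) : ℝ≥0∞ :=
  (∑ k ∈ Finset.Icc 1 T, ∑' s : HoldingTimes,
    stateLaw ch pol init k s * ENNReal.ofReal (errTrace A Q Pbar (h s))) / (T : ℝ≥0∞)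

end RemoteEstimation

end

/-!
Write `ρ` for `|λ_max(A)|` and `q` for `λ (1 - λ_e)`, so that the hypothesis on the threshold reads
`1 < q ρ ^ (2 (t + 1))`.

*Secrecy.* Under the threshold policy a reception is always followed by `t + 1` steps without one,
so windows that begin with a reception and contain another one within `t` steps have probability
zero under `P₀`. A finite divergence forces absolute continuity, hence they have probability zero
under `P₁` as well: under a stealthy policy such repetitions have vanishing frequency. Now follow
the event that each transmission reaches the legitimate estimator but not the adversary. Each
transmission then costs a factor `q` and buys `t` further steps of silence, so that the adversary
receives nothing for `m (t + 1)` steps with probability at least `q ^ m`, up to the probability of a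
repetition. This is `survival_le`, proved by induction on the number of steps from an arbitrary
state and for an arbitrary policy; no ergodicity and no stationary law is needed. In the time
average, `η^e ≥ m (t + 1)` thus has frequency at least `q ^ m / 2` for large horizons. The error
covariance grows at least like `ρ ^ (2 η^e)` (`exists_le_errTrace`: evaluate the quadratic form of
`f^h(P̄)` on a left eigenvector of `A`, on which `Q` is positive by controllability), so that the
average error is eventually at least a constant times `(q ρ ^ (2 (t + 1))) ^ m`, for every `m`.

*Stability.* For `ρ² < r` with `(1 - λ) r < 1`, Gelfand's formula bounds the growth of the error by
`r ^ k` over `k` steps (`exists_errTrace_le`). The discounted sum `∑ₖ r⁻ᵏ tr f^(h+k)(P̄)` then is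
finite and grows at most by the factor `r` in each step without reception. Weighted by a power of
the remaining silence of the sensor, it is a Lyapunov function for the chain of holding times
(`transit_lyapunov_le`), whose expectations are bounded uniformly in time.
-/

noncomputable section

namespace RemoteEstimation

/-! ### Expectations under discrete laws -/

/-- The expectation `∑ a, p a * f a` of a `[0, ∞]`-valued function under a discrete law. -/
def expect {α : Type*} (p : PMF α) (f : α → ℝ≥0∞) : ℝ≥0∞ := ∑' a, p a * f a

section Expect

variable {α β : Type*}

lemma expect_mono {p : PMF α} {f g : α → ℝ≥0∞} (h : ∀ a, f a ≤ g a) :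
    expect p f ≤ expect p g :=
  ENNReal.tsum_le_tsum fun a => by gcongr; exact h a

lemma expect_add (p : PMF α) (f g : α → ℝ≥0∞) :
    expect p (fun a => f a + g a) = expect p f + expect p g := by
  simp only [expect, mul_add, ENNReal.tsum_add]

lemma expect_const_mul (p : PMF α) (c : ℝ≥0∞) (f : α → ℝ≥0∞) :
    expect p (fun a => c * f a) = c * expect p f := by
  simp only [expect, mul_left_comm _ c, ENNReal.tsum_mul_left]

lemma expect_const (p : PMF α) (c : ℝ≥0∞) : expect p (fun _ => c) = c := by
  simp only [expect, ENNReal.tsum_mul_right, p.tsum_coe, one_mul]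

lemma expect_le_one {p : PMF α} {f : α → ℝ≥0∞} (h : ∀ a, f a ≤ 1) : expect p f ≤ 1 :=
  (expect_mono h).trans_eq (expect_const p 1)

lemma expect_pure (a : α) (f : α → ℝ≥0∞) : expect (PMF.pure a) f = f a := by
  classical
  rw [expect, tsum_eq_single a]
  · simp
  · intro b hb
    simp [hb]

lemma expect_bind (p : PMF α) (k : α → PMF β) (f : β → ℝ≥0∞) :
    expect (p.bind k) f = expect p fun a => expect (k a) f := by
  simp only [expect, PMF.bind_apply, ← ENNReal.tsum_mul_right, ← ENNReal.tsum_mul_left]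
  rw [ENNReal.tsum_comm]
  simp only [mul_assoc]

lemma expect_map (p : PMF α) (g : α → β) (f : β → ℝ≥0∞) :
    expect (p.map g) f = expect p fun a => f (g a) := by
  rw [PMF.map, expect_bind]
  simp only [Function.comp, expect_pure]

lemma expect_coin (p : I) (f : Bool → ℝ≥0∞) :
    expect (coin p) f = ENNReal.ofReal p * f true + ENNReal.ofReal (1 - p) * f false := by
  rw [expect, tsum_fintype, Fintype.sum_bool]
  simp [coin]

end Expect

lemma ofReal_add_ofReal_one_sub (p : I) :
    ENNReal.ofReal (p : ℝ) + ENNReal.ofReal (1 - (p : ℝ)) = 1 := by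
  rw [← ENNReal.ofReal_add p.2.1 (sub_nonneg.2 p.2.2)]
  simp

lemma ofReal_unitInterval_le_one (p : I) : ENNReal.ofReal (p : ℝ) ≤ 1 :=
  ENNReal.ofReal_le_one.2 p.2.2

/-! ### The chain of holding times -/

section Chain

variable (ch : Channel) (pol : Policy)

/-- The transition operator of the chain of holding times: `(transit f)(s)` is the expectation of
`f` after one step from `s`. -/
def transit (f : HoldingTimes → ℝ≥0∞) (s : HoldingTimes) : ℝ≥0∞ :=
  expect (step ch pol s) fun x => f x.2

lemma expect_stateLaw_succ (init : PMF HoldingTimes) (k : ℕ) (f : HoldingTimes → ℝ≥0∞) :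
    expect (stateLaw ch pol init (k + 1)) f =
      expect (stateLaw ch pol init k) (transit ch pol f) := by
  rw [stateLaw, expect_bind]
  simp only [expect_map]
  rfl

lemma expect_stateLaw_add (init : PMF HoldingTimes) (k L : ℕ) (f : HoldingTimes → ℝ≥0∞) :
    expect (stateLaw ch pol init (k + L)) f =
      expect (stateLaw ch pol init k) ((transit ch pol)^[L] f) := by
  induction L generalizing f with
  | zero => rfl
  | succ L ih => rw [← add_assoc, expect_stateLaw_succ, ih, Function.iterate_succ_apply]

variable {ch pol}

/-- With a perfect acknowledgment channel, one step has at most five outcomes. -/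
lemma expect_step (hA : (ch.lamA : ℝ) = 1) (s : HoldingTimes) (F : Bool × HoldingTimes → ℝ≥0∞) :
    expect (step ch pol s) F =
      ENNReal.ofReal (pol s.etaS s.etaE) *
        (ENNReal.ofReal ch.lam * (ENNReal.ofReal ch.lamE * F (true, ⟨0, 0, 0⟩) +
            ENNReal.ofReal (1 - ch.lamE) * F (true, ⟨0, 0, s.etaE + 1⟩)) +
          ENNReal.ofReal (1 - ch.lam) *
            (ENNReal.ofReal ch.lamE * F (false, ⟨s.eta + 1, s.etaS + 1, 0⟩) +
            ENNReal.ofReal (1 - ch.lamE) *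
              F (false, ⟨s.eta + 1, s.etaS + 1, s.etaE + 1⟩))) +
        ENNReal.ofReal (1 - pol s.etaS s.etaE) *
          F (false, ⟨s.eta + 1, s.etaS + 1, s.etaE + 1⟩) := by
  have h1 := ofReal_add_ofReal_one_sub ch.lam
  have h2 := ofReal_add_ofReal_one_sub ch.lamE
  simp [step, expect_bind, expect_coin, expect_pure, hA, ← add_mul, h1, h2]

/-- A lower bound for the expectation after one step that keeps two outcomes: a transmission that
only the legitimate estimator receives, and no transmission. -/
lemma le_expect_step (hA : (ch.lamA : ℝ) = 1) (s : HoldingTimes)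
    (F : Bool × HoldingTimes → ℝ≥0∞) :
    ENNReal.ofReal (pol s.etaS s.etaE) *
        (ENNReal.ofReal ch.lam * ENNReal.ofReal (1 - ch.lamE) * F (true, ⟨0, 0, s.etaE + 1⟩)) +
      ENNReal.ofReal (1 - pol s.etaS s.etaE) *
        F (false, ⟨s.eta + 1, s.etaS + 1, s.etaE + 1⟩) ≤ expect (step ch pol s) F := by
  rw [expect_step hA, mul_assoc (ENNReal.ofReal ch.lam)]
  gcongr
  exact le_add_right (by gcongr; exact le_add_self)

/-- A lower bound for the expectation after one step when receptions at the legitimate estimator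
pay at least `c`. -/
lemma le_expect_step_of_le (hA : (ch.lamA : ℝ) = 1) (s : HoldingTimes)
    (F : Bool × HoldingTimes → ℝ≥0∞) (c : ℝ≥0∞) (hF : ∀ s', c ≤ F (true, s')) :
    ENNReal.ofReal (pol s.etaS s.etaE) * (ENNReal.ofReal ch.lam * c) +
      ENNReal.ofReal (1 - pol s.etaS s.etaE) *
        F (false, ⟨s.eta + 1, s.etaS + 1, s.etaE + 1⟩) ≤ expect (step ch pol s) F := by
  rw [expect_step hA]
  have h2 := ofReal_add_ofReal_one_sub ch.lamE
  gcongr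
  refine le_add_right ?_
  gcongr
  calc c = ENNReal.ofReal ch.lamE * c + ENNReal.ofReal (1 - ch.lamE) * c := by
        rw [← add_mul, h2, one_mul]
    _ ≤ _ := by gcongr <;> exact hF _

variable (ch pol)

/-! ### Receptions in quick succession -/

/-- The probability that the legitimate estimator receives a packet within the next `c` steps. -/
def hitProb : ℕ → HoldingTimes → ℝ≥0∞
  | 0, _ => 0
  | c + 1, s => expect (step ch pol s) fun x => if x.1 then 1 else hitProb c x.2

/-- The probability that the legitimate estimator receives a packet in the next step and another
one within the `t` steps after that. -/
def repeatProb (t : ℕ) (s : HoldingTimes) : ℝ≥0∞ :=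
  expect (step ch pol s) fun x => if x.1 then hitProb ch pol t x.2 else 0

/-- The expected sum of `repeatProb` over the `L` states that are visited first, beginning with the
current one. -/
def repeatSum (t : ℕ) : ℕ → HoldingTimes → ℝ≥0∞
  | 0, _ => 0
  | L + 1, s => repeatProb ch pol t s + transit ch pol (repeatSum t L) s

/-- The indicator function of `m ≤ η^e`. -/
def etaEGe (m : ℕ) (s : HoldingTimes) : ℝ≥0∞ := if m ≤ s.etaE then 1 else 0

lemma etaEGe_le_one (m : ℕ) (s : HoldingTimes) : etaEGe m s ≤ 1 := by
  unfold etaEGe; split <;> simp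

lemma hitProb_le_one (c : ℕ) (s : HoldingTimes) : hitProb ch pol c s ≤ 1 := by
  induction c generalizing s with
  | zero => simp [hitProb]
  | succ c ih =>
    rw [hitProb]
    refine expect_le_one fun x => ?_
    split
    · exact le_rfl
    · exact ih _

lemma repeatProb_le_one (t : ℕ) (s : HoldingTimes) : repeatProb ch pol t s ≤ 1 := by
  refine expect_le_one fun x => ?_
  split
  · exact hitProb_le_one ..
  · simp

lemma expect_repeatSum (init : PMF HoldingTimes) (t k L : ℕ) :
    expect (stateLaw ch pol init k) (repeatSum ch pol t L) =
      ∑ i ∈ Finset.range L, expect (stateLaw ch pol init (k + i)) (repeatProb ch pol t) := by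
  induction L generalizing k with
  | zero => exact expect_const _ 0
  | succ L ih =>
    have : repeatSum ch pol t (L + 1) =
      fun s => repeatProb ch pol t s + transit ch pol (repeatSum ch pol t L) s := rfl
    rw [this, expect_add, ← expect_stateLaw_succ, ih, Finset.sum_range_succ', add_comm]
    simp only [add_assoc, add_comm 1, add_zero]

variable {ch pol}

/-- The survival estimate behind the theorem: a transmission that reaches the legitimate estimator
but not the adversary has probability `q = λ (1 - λ_e)`, and unless receptions repeat within `t`
steps it is followed by `t` steps of silence. So, up to the probability of repeated receptions, the
adversary receives nothing during `c + K (t + 1)` steps with probability at least `q ^ K`, where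
the first `c` of these steps are meant to be silent (`hitProb` is the probability that they are
not). The factor `λ` accounts for transmissions that break a silence: each of them is seen with
probability `λ` only. -/
lemma survival_le (hA : (ch.lamA : ℝ) = 1) (t : ℕ) (L : ℕ) :
    ∀ (c K m : ℕ) (s : HoldingTimes), L ≤ c + K * (t + 1) → m ≤ s.etaE →
    ENNReal.ofReal ch.lam * (ENNReal.ofReal ch.lam * ENNReal.ofReal (1 - ch.lamE)) ^ K ≤
      ENNReal.ofReal ch.lam * (transit ch pol)^[L] (etaEGe (m + L)) s +
        (hitProb ch pol c s + repeatSum ch pol t L s) := by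
  set l := ENNReal.ofReal ch.lam with hl
  set d := ENNReal.ofReal (1 - ch.lamE) with hd
  have hl1 : l ≤ 1 := ofReal_unitInterval_le_one _
  have hd1 : d ≤ 1 := ENNReal.ofReal_le_one.2 (by linarith [ch.lamE.2.1])
  have hq1 : l * d ≤ 1 := mul_le_one' hl1 hd1
  induction L with
  | zero =>
    intro c K m s _ hm
    refine le_add_right ?_
    simp only [Function.iterate_zero, id, etaEGe, add_zero, hm, if_true]
    gcongr
    exact pow_le_one' hq1 K
  | succ L ih =>
    intro c K m s hL hm
    have hp := ofReal_add_ofReal_one_sub (pol s.etaS s.etaE)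
    set p := ENNReal.ofReal (pol s.etaS s.etaE) with hpd
    set p' := ENNReal.ofReal (1 - pol s.etaS s.etaE) with hpd'
    have hidx : m + (L + 1) = m + 1 + L := by omega
    rw [Function.iterate_succ_apply', hidx]
    set u := (transit ch pol)^[L] (etaEGe (m + 1 + L)) with hu
    rcases c with _ | c
    · obtain ⟨K, rfl⟩ : ∃ K', K = K' + 1 := ⟨K - 1, by
        rcases K with _ | K
        · omega
        · rfl⟩
      have e : l * transit ch pol u s + (hitProb ch pol 0 s + repeatSum ch pol t (L + 1) s) =
          expect (step ch pol s) fun x => l * u x.2 +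
            ((if x.1 then hitProb ch pol t x.2 else 0) + repeatSum ch pol t L x.2) := by
        rw [expect_add, expect_add, expect_const_mul, hitProb, zero_add]
        rfl
      rw [e]
      refine le_trans ?_ (le_expect_step hA s _)
      have h1 := ih t K (m + 1) ⟨0, 0, s.etaE + 1⟩ (by
        have : (K + 1) * (t + 1) = K * (t + 1) + t + 1 := by ring
        omega) (by simpa using hm)
      have h2 := ih 0 (K + 1) (m + 1) ⟨s.eta + 1, s.etaS + 1, s.etaE + 1⟩ (by omega)
        (by simpa using hm)
      calc l * (l * d) ^ (K + 1)
          = p * (l * d * (l * (l * d) ^ K)) + p' * (l * (l * d) ^ (K + 1)) := by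
            rw [show l * d * (l * (l * d) ^ K) = l * (l * d) ^ (K + 1) by ring, ← add_mul, hp,
              one_mul]
        _ ≤ _ := by
            gcongr
            · simpa using h1
            · simpa [hitProb] using h2
    · have e : l * transit ch pol u s +
            (hitProb ch pol (c + 1) s + transit ch pol (repeatSum ch pol t L) s) =
          expect (step ch pol s) fun x => l * u x.2 +
            ((if x.1 then 1 else hitProb ch pol c x.2) + repeatSum ch pol t L x.2) := by
        rw [expect_add, expect_add, expect_const_mul]
        rfl
      have e' : l * transit ch pol u s +
            (hitProb ch pol (c + 1) s + transit ch pol (repeatSum ch pol t L) s) ≤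
          l * transit ch pol u s +
            (hitProb ch pol (c + 1) s + repeatSum ch pol t (L + 1) s) := by
        gcongr
        exact le_add_self
      refine le_trans ?_ e'
      rw [e]
      refine le_trans ?_ (le_expect_step_of_le hA s _ 1 fun s' => ?_)
      · have h2 := ih c K (m + 1) ⟨s.eta + 1, s.etaS + 1, s.etaE + 1⟩ (by omega)
          (by simpa using hm)
        calc l * (l * d) ^ K
            = p * (l * (l * d) ^ K) + p' * (l * (l * d) ^ K) := by
              rw [← add_mul, hp, one_mul]
          _ ≤ _ := by
            gcongr
            · exact pow_le_one' hq1 K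
            · simpa using h2
      · simp only [if_true]
        exact le_add_left (le_add_right le_rfl)

/-! ### Repeated receptions in an observation window -/

/-- The windows that begin with a reception and have another one within the next `t` steps. -/
def repeatWindows (t N : ℕ) : Set (Fin N → Bool) :=
  {w | (∃ i : Fin N, (i : ℕ) = 0 ∧ w i) ∧ ∃ j : Fin N, 0 < (j : ℕ) ∧ (j : ℕ) ≤ t ∧ w j}

open Classical in
/-- `hitProb` only depends on the first `c` entries of a longer window. -/
lemma expect_windowLaw_hit (c N : ℕ) (hc : c ≤ N) (s : HoldingTimes) :
    expect (windowLaw ch pol N s) (fun w => if ∃ j : Fin N, (j : ℕ) < c ∧ w j then 1 else 0) =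
      hitProb ch pol c s := by
  induction N generalizing c s with
  | zero =>
    obtain rfl : c = 0 := by omega
    simp [hitProb, expect_const]
  | succ N ih =>
    rcases c with _ | c
    · simp [hitProb, expect_const]
    · rw [windowLaw, expect_bind, hitProb]
      congr 1
      funext x
      rw [expect_map]
      rcases hx : x.1 with _ | _
      · simp only [Fin.exists_fin_succ, Fin.cons_zero, Fin.cons_succ, Fin.val_succ,
          Nat.add_lt_add_iff_right, Bool.false_eq_true, and_false, false_or, if_false]
        exact ih c (by omega) x.2
      · simp [Fin.exists_fin_succ, expect_const]

open Classical in
lemma expect_windowLaw_repeat (t N : ℕ) (hN : t < N) (s : HoldingTimes) :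
    expect (windowLaw ch pol N s) (fun w => if w ∈ repeatWindows t N then 1 else 0) =
      repeatProb ch pol t s := by
  rcases N with _ | N
  · omega
  · rw [windowLaw, expect_bind, repeatProb]
    congr 1
    funext x
    rw [expect_map]
    rcases hx : x.1 with _ | _
    · simp [repeatWindows, Fin.exists_fin_succ, expect_const]
    · rw [← expect_windowLaw_hit t N (by omega)]
      simp [repeatWindows, Fin.exists_fin_succ]

open Classical in
lemma sum_obsLaw_repeatWindows (init : PMF HoldingTimes) (t N : ℕ) (hN : t < N) (k : ℕ) :
    ∑ w : Fin N → Bool with w ∈ repeatWindows t N, obsLaw ch pol init N k w =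
      expect (stateLaw ch pol init k) (repeatProb ch pol t) := by
  have : repeatProb ch pol t = fun s => expect (windowLaw ch pol N s)
      (fun w => if w ∈ repeatWindows t N then 1 else 0) := by
    funext s
    rw [expect_windowLaw_repeat t N hN]
  rw [this, ← expect_bind, expect, tsum_fintype, Finset.sum_filter]
  simp [obsLaw]

lemma hitProb_thresholdPolicy (hA : (ch.lamA : ℝ) = 1) (t c : ℕ) (s : HoldingTimes)
    (h : s.etaS + c ≤ t + 1) : hitProb ch (thresholdPolicy t) c s = 0 := by
  induction c generalizing s with
  | zero => rfl
  | succ c ih =>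
    have : ¬ t < s.etaS := by omega
    rw [hitProb, expect_step hA]
    simp [thresholdPolicy, this]
    exact ih _ (by simp; omega)

lemma repeatProb_thresholdPolicy (hA : (ch.lamA : ℝ) = 1) (t : ℕ) (s : HoldingTimes) :
    repeatProb ch (thresholdPolicy t) t s = 0 := by
  rw [repeatProb, expect_step hA]
  simp [hitProb_thresholdPolicy hA]

end Chain

/-! ### Quadratic forms and traces -/

section Matrices

open Matrix

variable {n p : ℕ}

lemma posSemidef_conj {m : ℕ} {X : Matrix (Fin n) (Fin n) ℝ} (hX : X.PosSemidef)
    (B : Matrix (Fin m) (Fin n) ℝ) : (B * X * Bᵀ).PosSemidef := by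
  simpa [conjTranspose_eq_transpose_of_trivial] using hX.mul_mul_conjTranspose_same B

lemma quadForm_nonneg {X : Matrix (Fin n) (Fin n) ℝ} (hX : X.PosSemidef) (x : Fin n → ℝ) :
    0 ≤ x ⬝ᵥ X *ᵥ x := by
  simpa using hX.dotProduct_mulVec_nonneg x

lemma quadForm_conj (A X : Matrix (Fin n) (Fin n) ℝ) (x : Fin n → ℝ) :
    x ⬝ᵥ (A * X * Aᵀ) *ᵥ x = (x ᵥ* A) ⬝ᵥ X *ᵥ (x ᵥ* A) := by
  rw [← mulVec_mulVec, ← mulVec_mulVec, mulVec_transpose, dotProduct_mulVec]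

lemma quadForm_le_trace {X : Matrix (Fin n) (Fin n) ℝ} (hX : X.PosSemidef) (x : Fin n → ℝ) :
    x ⬝ᵥ X *ᵥ x ≤ (x ⬝ᵥ x) * X.trace := by
  obtain ⟨m, B, rfl⟩ := posSemidef_iff_eq_sum_vecMulVec.1 hX
  simp only [star_trivial, trace_sum, trace_vecMulVec, Finset.mul_sum, sum_mulVec, dotProduct_sum]
  gcongr with i
  have h := Finset.sum_mul_sq_le_sq_mul_sq Finset.univ x (B i)
  calc x ⬝ᵥ vecMulVec (B i) (B i) *ᵥ x = (∑ j, x j * B i j) ^ 2 := by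
        rw [dotProduct_mulVec, vecMul_vecMulVec, smul_dotProduct, dotProduct_comm (B i) x,
          smul_eq_mul, ← sq]
        rfl
    _ ≤ _ := by simpa [dotProduct, sq] using h

lemma trace_conj_le {X : Matrix (Fin n) (Fin n) ℝ} (hX : X.PosSemidef)
    (B : Matrix (Fin n) (Fin n) ℝ) : (B * X * Bᵀ).trace ≤ (∑ i, ∑ j, B i j ^ 2) * X.trace := by
  rw [trace, Finset.sum_mul]
  refine Finset.sum_le_sum fun i _ => ?_
  have h := quadForm_le_trace hX (B i)
  have e : (B * X * Bᵀ).diag i = B i ⬝ᵥ X *ᵥ B i := by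
    rw [diag_apply, dotProduct_mulVec, ← mul_apply_eq_vecMul, mul_apply]
    rfl
  rw [e]
  simpa [dotProduct, sq] using h

/-! ### The error covariances -/

/-- Joseph's form `(I - K C) M (I - K C)ᵀ + K R Kᵀ` of the posterior error covariance shows that it
is positive semidefinite. -/
lemma IsKalmanUpdate.posSemidef {C : Matrix (Fin p) (Fin n) ℝ} {R : Matrix (Fin p) (Fin p) ℝ}
    {M P : Matrix (Fin n) (Fin n) ℝ} (hR : R.PosSemidef) (hM : M.PosSemidef)
    (h : IsKalmanUpdate C R M P) : P.PosSemidef := by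
  obtain ⟨K, hK, rfl⟩ := h
  have hMt : Mᵀ = M := by simpa [conjTranspose_eq_transpose_of_trivial] using hM.isHermitian.eq
  have hRt : Rᵀ = R := by simpa [conjTranspose_eq_transpose_of_trivial] using hR.isHermitian.eq
  have h1 : K * (C * M * Cᵀ + R) * Kᵀ = M * Cᵀ * Kᵀ := by rw [hK]
  have h2 : K * (C * M * Cᵀ + R) * Kᵀ = K * C * M := by
    have := congrArg transpose h1
    simpa [transpose_mul, transpose_add, hMt, hRt, Matrix.mul_assoc] using this
  have e : M - K * C * M = (1 - K * C) * M * (1 - K * C)ᵀ + K * R * Kᵀ := by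
    have h3 : (1 - K * C) * M * (1 - K * C)ᵀ + K * R * Kᵀ =
        M - K * C * M - M * Cᵀ * Kᵀ + K * (C * M * Cᵀ + R) * Kᵀ := by
      simp only [transpose_sub, transpose_one, transpose_mul, Matrix.mul_add, Matrix.add_mul,
        Matrix.mul_sub, Matrix.sub_mul, Matrix.mul_one, Matrix.one_mul, Matrix.mul_assoc]
      abel
    rw [h3, h1, sub_add_cancel]
  rw [e]
  exact (posSemidef_conj hM _).add (posSemidef_conj hR _)

lemma posSemidef_predict {A Q X : Matrix (Fin n) (Fin n) ℝ} (hQ : Q.PosSemidef)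
    (hX : X.PosSemidef) : (predict A Q X).PosSemidef :=
  (posSemidef_conj hX A).add hQ

lemma posSemidef_iterate_predict {A Q X : Matrix (Fin n) (Fin n) ℝ} (hQ : Q.PosSemidef)
    (hX : X.PosSemidef) (k : ℕ) : ((predict A Q)^[k] X).PosSemidef := by
  induction k with
  | zero => exact hX
  | succ k ih => rw [Function.iterate_succ_apply']; exact posSemidef_predict hQ ih

lemma posSemidef_of_tendsto {P : ℕ → Matrix (Fin n) (Fin n) ℝ} {X : Matrix (Fin n) (Fin n) ℝ}
    (hP : ∀ k, (P k).PosSemidef) (h : Tendsto P atTop (𝓝 X)) : X.PosSemidef := by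
  refine PosSemidef.of_dotProduct_mulVec_nonneg ?_ fun x => ?_
  · have h1 : Tendsto (fun k => (P k)ᴴ) atTop (𝓝 Xᴴ) :=
      (continuous_id.matrix_conjTranspose.tendsto X).comp h
    have h2 : (fun k => (P k)ᴴ) = P := funext fun k => (hP k).isHermitian.eq
    rw [h2] at h1
    exact tendsto_nhds_unique h1 h
  · have hc : Continuous fun Y : Matrix (Fin n) (Fin n) ℝ => star x ⬝ᵥ Y *ᵥ x :=
      continuous_const.dotProduct (continuous_id.matrix_mulVec continuous_const)
    exact ge_of_tendsto' ((hc.tendsto X).comp h) fun k => (hP k).dotProduct_mulVec_nonneg x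

lemma IsSteadyStateCov.posSemidef {A Q : Matrix (Fin n) (Fin n) ℝ} {C : Matrix (Fin p) (Fin n) ℝ}
    {R : Matrix (Fin p) (Fin p) ℝ} {Pbar : Matrix (Fin n) (Fin n) ℝ} (hQ : Q.PosSemidef)
    (hR : R.PosSemidef) (h : IsSteadyStateCov A C Q R Pbar) : Pbar.PosSemidef := by
  obtain ⟨M₀, P, hM₀, h0, hs, hlim⟩ := h
  refine posSemidef_of_tendsto (fun k => ?_) hlim
  induction k with
  | zero => exact h0.posSemidef hR hM₀
  | succ k ih => exact (hs k).posSemidef hR (posSemidef_predict hQ ih)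

lemma errTrace_nonneg {A Q Pbar : Matrix (Fin n) (Fin n) ℝ} (hQ : Q.PosSemidef)
    (hP : Pbar.PosSemidef) (h : ℕ) : 0 ≤ errTrace A Q Pbar h :=
  (posSemidef_iterate_predict hQ hP h).trace_nonneg

/-! ### Exponential growth of the error covariances -/

section Frobenius

open scoped Matrix.Norms.Frobenius

/-- A left eigenvector `x + i y` of `A` for an eigenvalue `a + i b` of the largest modulus, in real
coordinates. -/
lemma exists_left_eigenvector (A : Matrix (Fin n) (Fin n) ℝ) (hA : 1 < maxEig A) :
    ∃ (a b : ℝ) (x y : Fin n → ℝ), a ^ 2 + b ^ 2 = maxEig A ^ 2 ∧ (x ≠ 0 ∨ y ≠ 0) ∧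
      x ᵥ* A = a • x - b • y ∧ y ᵥ* A = b • x + a • y := by
  set Ac := A.map (algebraMap ℝ ℂ) with hAc
  have hne : (spectrum ℂ Ac).Nonempty := by
    by_contra hcon
    rw [Set.not_nonempty_iff_eq_empty] at hcon
    have : maxEig A = 0 := by rw [maxEig, ← hAc, spectralRadius, hcon]; simp
    linarith
  have : CompleteSpace (Matrix (Fin n) (Fin n) ℂ) := FiniteDimensional.complete ℂ _
  obtain ⟨μ, hμ, hμr⟩ := spectrum.exists_nnnorm_eq_spectralRadius_of_nonempty hne
  have hdet : (algebraMap ℂ (Matrix (Fin n) (Fin n) ℂ) μ - Ac).det = 0 := by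
    rw [spectrum.mem_iff, Matrix.isUnit_iff_isUnit_det, isUnit_iff_ne_zero, not_not] at hμ
    exact hμ
  obtain ⟨v, hv0, hv⟩ := Matrix.exists_vecMul_eq_zero_iff.2 hdet
  have hv' : ∀ j, ∑ i, v i * (A i j : ℂ) = μ * v j := by
    intro j
    rw [Matrix.vecMul_sub, sub_eq_zero] at hv
    have := congrFun hv j
    simp only [Matrix.algebraMap_eq_diagonal, Matrix.vecMul_diagonal] at this
    simpa [Matrix.vecMul, dotProduct, hAc, mul_comm] using this.symm
  refine ⟨μ.re, μ.im, fun i => (v i).re, fun i => (v i).im, ?_, ?_, ?_, ?_⟩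
  · have : maxEig A = ‖μ‖ := by
      rw [maxEig, ← hAc, ← hμr]
      simp
    rw [this, Complex.sq_norm, Complex.normSq_apply]
    ring
  · by_contra hcon
    push Not at hcon
    apply hv0
    funext i
    exact Complex.ext (congrFun hcon.1 i) (congrFun hcon.2 i)
  · funext j
    have := congrArg Complex.re (hv' j)
    simpa [Matrix.vecMul, dotProduct] using this
  · funext j
    have := congrArg Complex.im (hv' j)
    simp [Matrix.vecMul, dotProduct] at this ⊢
    linarith

/-- The powers of `A` grow at most like `s ^ k` for every `s > |λ_max(A)|`. -/
lemma exists_sum_sq_pow_le (A : Matrix (Fin n) (Fin n) ℝ) {s : ℝ} (hs : maxEig A < s) :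
    ∃ c, 0 ≤ c ∧ ∀ k, ∑ i, ∑ j, (A ^ k) i j ^ 2 ≤ c * (s ^ 2) ^ k := by
  set Ac := A.map (algebraMap ℝ ℂ) with hAc
  have : CompleteSpace (Matrix (Fin n) (Fin n) ℂ) := FiniteDimensional.complete ℂ _
  have hs0 : 0 < s := lt_of_le_of_lt ENNReal.toReal_nonneg hs
  have hfin : spectralRadius ℂ Ac ≠ ⊤ := by
    rcases (spectrum ℂ Ac).eq_empty_or_nonempty with he | hne
    · simp [spectralRadius, he]
    · obtain ⟨μ, -, hμr⟩ := spectrum.exists_nnnorm_eq_spectralRadius_of_nonempty hne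
      rw [← hμr]
      exact ENNReal.coe_ne_top
  have hlt : spectralRadius ℂ Ac < ENNReal.ofReal s := by
    rw [← ENNReal.ofReal_toReal hfin]
    exact (ENNReal.ofReal_lt_ofReal_iff hs0).2 hs
  have hev := (spectrum.pow_norm_pow_one_div_tendsto_nhds_spectralRadius Ac).eventually
    (gt_mem_nhds hlt)
  have hev2 : ∀ᶠ k in atTop, ‖Ac ^ k‖ / s ^ k ≤ 1 := by
    filter_upwards [hev, eventually_gt_atTop 0] with k hk hk0
    rw [ENNReal.ofReal_lt_ofReal_iff hs0] at hk
    rw [div_le_one (by positivity)]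
    have hk0' : (k : ℝ) ≠ 0 := by positivity
    calc ‖Ac ^ k‖ = (‖Ac ^ k‖ ^ (1 / k : ℝ)) ^ k := by
          rw [← Real.rpow_natCast, ← Real.rpow_mul (norm_nonneg _), one_div_mul_cancel hk0',
            Real.rpow_one]
      _ ≤ s ^ k := by gcongr
  obtain ⟨c, hc⟩ := (IsBoundedUnder.bddAbove_range (f := fun k : ℕ => ‖Ac ^ k‖ / s ^ k)
    ⟨1, by simpa using hev2⟩)
  have hc' : ∀ k, ‖Ac ^ k‖ ≤ c * s ^ k := fun k =>
    (div_le_iff₀ (by positivity)).1 (hc ⟨k, rfl⟩)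
  refine ⟨c ^ 2, sq_nonneg c, fun k => ?_⟩
  have e : ∑ i, ∑ j, (A ^ k) i j ^ 2 = ‖Ac ^ k‖ ^ 2 := by
    have h1 : Ac ^ k = (A ^ k).map (algebraMap ℝ ℂ) := by
      rw [hAc]
      exact (map_pow (algebraMap ℝ ℂ).mapMatrix A k).symm
    rw [h1, Matrix.frobenius_norm_def, ← Real.rpow_natCast, ← Real.rpow_mul (by positivity)]
    simp
  rw [e]
  calc ‖Ac ^ k‖ ^ 2 ≤ (c * s ^ k) ^ 2 := by gcongr; exact hc' k
    _ = c ^ 2 * (s ^ 2) ^ k := by ring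

end Frobenius

/-- Controllability makes the quadratic form of `Q` positive on a left eigenvector, which is what
keeps the error covariance growing along it. -/
lemma quadForm_pos_of_controllable {A S : Matrix (Fin n) (Fin n) ℝ} (hS : S.PosSemidef)
    (hctrl : Controllable A S) {a b : ℝ} {x y : Fin n → ℝ} (h0 : x ≠ 0 ∨ y ≠ 0)
    (hx : x ᵥ* A = a • x - b • y) (hy : y ᵥ* A = b • x + a • y) :
    0 < x ⬝ᵥ (S * S) *ᵥ x + y ⬝ᵥ (S * S) *ᵥ y := by
  have hSt : Sᵀ = S := by simpa [conjTranspose_eq_transpose_of_trivial] using hS.isHermitian.eq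
  have e : ∀ z : Fin n → ℝ, z ⬝ᵥ (S * S) *ᵥ z = (z ᵥ* S) ⬝ᵥ (z ᵥ* S) := by
    intro z
    rw [← mulVec_mulVec, dotProduct_mulVec, ← mulVec_transpose, hSt]
  have hnn : ∀ z : Fin n → ℝ, 0 ≤ z ⬝ᵥ z := fun z => by
    simpa using dotProduct_star_self_nonneg z
  rw [e, e]
  by_contra hcon
  have hx0 : x ᵥ* S = 0 := dotProduct_self_eq_zero.1 (by linarith [hnn (x ᵥ* S), hnn (y ᵥ* S)])
  have hy0 : y ᵥ* S = 0 := dotProduct_self_eq_zero.1 (by linarith [hnn (x ᵥ* S), hnn (y ᵥ* S)])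
  have key : ∀ k : ℕ, x ᵥ* (A ^ k * S) = 0 ∧ y ᵥ* (A ^ k * S) = 0 := by
    intro k
    induction k with
    | zero => simp [hx0, hy0]
    | succ k ih =>
      rw [pow_succ', Matrix.mul_assoc, ← vecMul_vecMul x, ← vecMul_vecMul y, hx, hy]
      simp [sub_vecMul, add_vecMul, smul_vecMul, ih.1, ih.2]
  have orth : ∀ z : Fin n → ℝ, (∀ k : ℕ, z ᵥ* (A ^ k * S) = 0) → z = 0 := by
    intro z hz
    have hle : (⨆ k : Fin n, LinearMap.range (A ^ (k : ℕ) * S).mulVecLin) ≤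
        LinearMap.ker (dotProductBilin ℝ ℝ z) := by
      refine iSup_le fun k => ?_
      rintro _ ⟨u, rfl⟩
      simp [dotProduct_mulVec, hz k]
    rw [show _ = _ from hctrl] at hle
    have := hle (Submodule.mem_top (x := z))
    simpa using this
  rcases h0 with h0 | h0
  · exact h0 (orth x fun k => (key k).1)
  · exact h0 (orth y fun k => (key k).2)

lemma exists_le_errTrace {A S Pbar : Matrix (Fin n) (Fin n) ℝ} (hS : S.PosSemidef)
    (hctrl : Controllable A S) (hA : 1 < maxEig A) (hP : Pbar.PosSemidef)
    (hQ : (S * S).PosSemidef) :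
    ∃ c, 0 < c ∧ ∀ h, 0 < h → c * (maxEig A ^ 2) ^ h ≤ errTrace A (S * S) Pbar h := by
  obtain ⟨a, b, x, y, hab, h0, hx, hy⟩ := exists_left_eigenvector A hA
  have hδ := quadForm_pos_of_controllable hS hctrl h0 hx hy
  set g : Matrix (Fin n) (Fin n) ℝ → ℝ := fun X => x ⬝ᵥ X *ᵥ x + y ⬝ᵥ X *ᵥ y with hg
  have hrec : ∀ X, g (predict A (S * S) X) = maxEig A ^ 2 * g X + g (S * S) := by
    intro X
    simp only [hg, predict, add_mulVec, dotProduct_add, quadForm_conj, hx, hy, mulVec_sub,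
      mulVec_add, mulVec_smul, dotProduct_sub, sub_dotProduct, add_dotProduct, dotProduct_smul,
      smul_dotProduct, smul_eq_mul, ← hab]
    ring
  have hgpos : ∀ k, (maxEig A ^ 2) ^ k * g (S * S) ≤ g ((predict A (S * S))^[k + 1] Pbar) := by
    intro k
    have hnn : ∀ k, 0 ≤ g ((predict A (S * S))^[k] Pbar) := fun k =>
      add_nonneg (quadForm_nonneg (posSemidef_iterate_predict hQ hP k) x)
        (quadForm_nonneg (posSemidef_iterate_predict hQ hP k) y)
    induction k with
    | zero =>
      rw [Function.iterate_succ_apply', hrec, pow_zero, one_mul]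
      exact le_add_of_nonneg_left (mul_nonneg (sq_nonneg _) (hnn 0))
    | succ k ih =>
      rw [Function.iterate_succ_apply', hrec, pow_succ', mul_assoc]
      have := mul_le_mul_of_nonneg_left ih (sq_nonneg (maxEig A))
      have h2 : 0 < g (S * S) := hδ
      linarith
  have hgt : ∀ k, g ((predict A (S * S))^[k] Pbar) ≤
      (x ⬝ᵥ x + y ⬝ᵥ y) * errTrace A (S * S) Pbar k := by
    intro k
    have hX := posSemidef_iterate_predict (A := A) hQ hP k
    rw [add_mul]
    exact add_le_add (quadForm_le_trace hX x) (quadForm_le_trace hX y)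
  have hnn : ∀ z : Fin n → ℝ, 0 ≤ z ⬝ᵥ z := fun z => by
    simpa using dotProduct_star_self_nonneg z
  have hN : 0 < x ⬝ᵥ x + y ⬝ᵥ y := by
    rcases h0 with h | h
    · exact add_pos_of_pos_of_nonneg
        ((hnn x).lt_of_ne fun h' => h (dotProduct_self_eq_zero.1 h'.symm)) (hnn y)
    · exact add_pos_of_nonneg_of_pos (hnn x)
        ((hnn y).lt_of_ne fun h' => h (dotProduct_self_eq_zero.1 h'.symm))
  have hρ : 0 < maxEig A ^ 2 := by positivity
  refine ⟨g (S * S) / (maxEig A ^ 2 * (x ⬝ᵥ x + y ⬝ᵥ y)), div_pos hδ (by positivity), ?_⟩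
  intro h hh
  obtain ⟨k, rfl⟩ : ∃ k, h = k + 1 := ⟨h - 1, by omega⟩
  have h1 := (hgpos k).trans (hgt (k + 1))
  rw [pow_succ, div_mul_eq_mul_div, div_le_iff₀ (by positivity)]
  calc g (S * S) * ((maxEig A ^ 2) ^ k * maxEig A ^ 2)
      = maxEig A ^ 2 * ((maxEig A ^ 2) ^ k * g (S * S)) := by ring
    _ ≤ maxEig A ^ 2 * ((x ⬝ᵥ x + y ⬝ᵥ y) * errTrace A (S * S) Pbar (k + 1)) := by gcongr
    _ = _ := by ring

lemma iterate_predict (A Q X : Matrix (Fin n) (Fin n) ℝ) (k : ℕ) :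
    (predict A Q)^[k] X = A ^ k * X * (A ^ k)ᵀ + ∑ i ∈ Finset.range k, A ^ i * Q * (A ^ i)ᵀ := by
  induction k with
  | zero => simp
  | succ k ih =>
    rw [Function.iterate_succ_apply', ih, Finset.sum_range_succ', predict]
    simp only [mul_add, add_mul, Finset.mul_sum, Finset.sum_mul, pow_succ', transpose_mul,
      Matrix.mul_assoc, pow_zero, transpose_one, Matrix.mul_one, Matrix.one_mul, add_assoc]

lemma exists_errTrace_le {A Q Pbar : Matrix (Fin n) (Fin n) ℝ} (hQ : Q.PosSemidef)
    (hP : Pbar.PosSemidef) {r : ℝ} (h1 : 1 < r) (hr : maxEig A ^ 2 < r) :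
    ∃ c, 0 ≤ c ∧ ∀ h k, errTrace A Q Pbar (h + k) ≤ c * r ^ k * (errTrace A Q Pbar h + 1) := by
  have hs : maxEig A < √r := Real.lt_sqrt_of_sq_lt hr
  obtain ⟨c, hc0, hc⟩ := exists_sum_sq_pow_le A hs
  rw [Real.sq_sqrt (by linarith)] at hc
  have hr1 : 0 < r - 1 := by linarith
  have hQt := hQ.trace_nonneg
  refine ⟨c + c * Q.trace / (r - 1), by positivity, fun h k => ?_⟩
  have he := errTrace_nonneg (A := A) hQ hP h
  have hX := posSemidef_iterate_predict (A := A) hQ hP h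
  have e : errTrace A Q Pbar (h + k) = (A ^ k * ((predict A Q)^[h] Pbar) * (A ^ k)ᵀ).trace +
      ∑ i ∈ Finset.range k, (A ^ i * Q * (A ^ i)ᵀ).trace := by
    rw [errTrace, add_comm h k, Function.iterate_add_apply, iterate_predict A Q _ k, trace_add,
      trace_sum]
  have b1 : (A ^ k * ((predict A Q)^[h] Pbar) * (A ^ k)ᵀ).trace ≤
      c * r ^ k * errTrace A Q Pbar h :=
    (trace_conj_le hX _).trans (mul_le_mul_of_nonneg_right (hc k) he)
  have b2 : ∑ i ∈ Finset.range k, (A ^ i * Q * (A ^ i)ᵀ).trace ≤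
      c * Q.trace / (r - 1) * r ^ k := by
    calc _ ≤ ∑ i ∈ Finset.range k, c * r ^ i * Q.trace :=
          Finset.sum_le_sum fun i _ =>
            (trace_conj_le hQ _).trans (mul_le_mul_of_nonneg_right (hc i) hQt)
      _ = c * Q.trace * ((r ^ k - 1) / (r - 1)) := by
          rw [← geom_sum_eq h1.ne', Finset.mul_sum]
          exact Finset.sum_congr rfl fun i _ => by ring
      _ ≤ c * Q.trace * (r ^ k / (r - 1)) := by gcongr; linarith
      _ = _ := by ring
  have p1 : 0 ≤ c * r ^ k := by positivity
  have p2 : 0 ≤ c * Q.trace / (r - 1) * r ^ k * errTrace A Q Pbar h := by positivity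
  rw [e]
  nlinarith

end Matrices

/-! ### Secrecy: unbounded errors at the adversary -/

section Averages

lemma sum_range_shift_le {f : ℕ → ℝ≥0∞} (hf : ∀ k, f k ≤ 1) (T i : ℕ) :
    ∑ k ∈ Finset.range T, f (k + i) ≤ ∑ k ∈ Finset.range T, f k + i := by
  induction i with
  | zero => simp
  | succ i ih =>
    calc ∑ k ∈ Finset.range T, f (k + (i + 1))
        ≤ ∑ k ∈ Finset.range T, f (k + (i + 1)) + f (0 + i) := le_self_add
      _ = ∑ k ∈ Finset.range (T + 1), f (k + i) := by
          rw [Finset.sum_range_succ']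
          simp only [add_assoc, add_comm 1 i]
      _ ≤ ∑ k ∈ Finset.range T, f k + i + 1 := by
          rw [Finset.sum_range_succ]
          exact add_le_add ih (hf _)
      _ = _ := by push_cast; ring

/-- If `b` vanishes on time average, then it does not affect the time average of `x` in a lower
bound that holds at each time, up to a factor `1 / 2`. -/
lemma eventually_half_le_average {x b : ℕ → ℝ≥0∞} (hx : ∀ k, x k ≤ 1) (hb : ∀ k, b k ≤ 1)
    {a l : ℝ≥0∞} (ha0 : a ≠ 0) (ha : a ≠ ⊤) (hl : l ≤ 1) (S L : ℕ)
    (h : ∀ k, a ≤ l * x (k + S) + ∑ i ∈ Finset.range L, b (k + i))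
    (hlim : Tendsto (fun T : ℕ => (∑ k ∈ Finset.range T, b k) / (T : ℝ≥0∞)) atTop (𝓝 0)) :
    ∀ᶠ T : ℕ in atTop, a / 2 ≤ l * ((∑ k ∈ Finset.range T, x k) / (T : ℝ≥0∞)) := by
  have hrem : Tendsto (fun T : ℕ => ((S + L * L : ℕ) : ℝ≥0∞) / (T : ℝ≥0∞) +
      L * ((∑ k ∈ Finset.range T, b k) / (T : ℝ≥0∞))) atTop (𝓝 0) := by
    have h1 : Tendsto (fun T : ℕ => ((S + L * L : ℕ) : ℝ≥0∞) / (T : ℝ≥0∞)) atTop (𝓝 0) := by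
      have := ENNReal.Tendsto.const_mul (a := ((S + L * L : ℕ) : ℝ≥0∞))
        ENNReal.tendsto_inv_nat_nhds_zero (Or.inr (ENNReal.natCast_ne_top _))
      simpa [div_eq_mul_inv] using this
    have h2 := ENNReal.Tendsto.const_mul (a := (L : ℝ≥0∞)) hlim
      (Or.inr (ENNReal.natCast_ne_top _))
    simpa using h1.add h2
  have hhalf : 0 < a / 2 := ENNReal.half_pos ha0
  have hhalf' : a / 2 ≠ ⊤ := (ENNReal.half_lt_self ha0 ha).ne_top
  filter_upwards [hrem.eventually (gt_mem_nhds hhalf), eventually_gt_atTop 0] with T hT hT0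
  have hTne : (T : ℝ≥0∞) ≠ 0 := by exact_mod_cast hT0.ne'
  have hTtop : (T : ℝ≥0∞) ≠ ⊤ := ENNReal.natCast_ne_top _
  set X := ∑ k ∈ Finset.range T, x k
  set B := ∑ k ∈ Finset.range T, b k
  have hsum : (T : ℝ≥0∞) * a ≤ l * X + (((S + L * L : ℕ) : ℝ≥0∞) + L * B) := by
    calc (T : ℝ≥0∞) * a = ∑ _k ∈ Finset.range T, a := by simp
      _ ≤ ∑ k ∈ Finset.range T, (l * x (k + S) + ∑ i ∈ Finset.range L, b (k + i)) :=
          Finset.sum_le_sum fun k _ => h k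
      _ = l * ∑ k ∈ Finset.range T, x (k + S) +
            ∑ i ∈ Finset.range L, ∑ k ∈ Finset.range T, b (k + i) := by
          rw [Finset.sum_add_distrib, ← Finset.mul_sum, Finset.sum_comm]
      _ ≤ l * (X + S) + ∑ i ∈ Finset.range L, (B + L) := by
          gcongr with i hi
          · exact sum_range_shift_le hx T S
          · refine (sum_range_shift_le hb T i).trans ?_
            gcongr
            exact (Finset.mem_range.1 hi).le
      _ = l * X + (l * S + (L * B + L * L)) := by
          simp only [Finset.sum_const, Finset.card_range, nsmul_eq_mul]; ring
      _ ≤ l * X + (1 * S + (L * B + L * L)) := by gcongr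
      _ = _ := by push_cast; ring
  have hdiv : a ≤ l * (X / T) + (((S + L * L : ℕ) : ℝ≥0∞) / T + L * (B / T)) := by
    calc a = (T : ℝ≥0∞) * a / T := by
          rw [mul_comm, ENNReal.mul_div_cancel_right hTne hTtop]
      _ ≤ (l * X + (((S + L * L : ℕ) : ℝ≥0∞) + L * B)) / T := by gcongr
      _ = _ := by simp only [div_eq_mul_inv]; ring
  refine (ENNReal.add_le_add_iff_right hhalf').1 ?_
  rw [ENNReal.add_halves]
  exact hdiv.trans (by gcongr)

end Averages

section Secrecy

variable {ch : Channel}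

lemma IsLongRunObsLaw.apply_eq_zero_of_threshold (hA : (ch.lamA : ℝ) = 1) {t N : ℕ} (hN : t < N)
    {init : PMF HoldingTimes} {P : PMF (Fin N → Bool)}
    (hP : IsLongRunObsLaw ch (thresholdPolicy t) init N P) {w : Fin N → Bool}
    (hw : w ∈ repeatWindows t N) : P w = 0 := by
  classical
  have h0 : ∀ k, obsLaw ch (thresholdPolicy t) init N k w = 0 := by
    intro k
    have h := sum_obsLaw_repeatWindows (ch := ch) (pol := thresholdPolicy t) init t N hN k
    rw [funext (repeatProb_thresholdPolicy hA t), expect_const, Finset.sum_eq_zero_iff] at h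
    exact h w (by simpa using hw)
  refine tendsto_nhds_unique (hP w) ?_
  simp [h0]

lemma apply_eq_zero_of_klDiv_ne_top {α : Type*} [MeasurableSpace α] [MeasurableSingletonClass α]
    {P₁ P₀ : PMF α} (h : InformationTheory.klDiv P₁.toMeasure P₀.toMeasure ≠ ⊤) {w : α}
    (hw : P₀ w = 0) : P₁ w = 0 := by
  have hac := (InformationTheory.klDiv_ne_top_iff.1 h).1
  have h0 : P₀.toMeasure {w} = 0 := by
    rw [PMF.toMeasure_apply_singleton _ _ (measurableSet_singleton w), hw]
  have h1 := hac h0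
  rwa [PMF.toMeasure_apply_singleton _ _ (measurableSet_singleton w)] at h1

lemma tendsto_average_repeatProb {pol : Policy} {t N : ℕ} (hN : t < N) {init : PMF HoldingTimes}
    {P : PMF (Fin N → Bool)} (hP : IsLongRunObsLaw ch pol init N P)
    (h0 : ∀ w ∈ repeatWindows t N, P w = 0) :
    Tendsto (fun T : ℕ => (∑ k ∈ Finset.range T,
      expect (stateLaw ch pol init k) (repeatProb ch pol t)) / (T : ℝ≥0∞)) atTop (𝓝 0) := by
  classical
  have h := tendsto_finsetSum (Finset.univ.filter (· ∈ repeatWindows t N)) fun w _ => hP w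
  rw [Finset.sum_eq_zero fun w hw => h0 w (Finset.mem_filter.1 hw).2] at h
  refine h.congr fun T => ?_
  simp only [← sum_obsLaw_repeatWindows init t N hN, div_eq_mul_inv]
  rw [← Finset.sum_mul, Finset.sum_comm]

/-- When receptions repeat within `t` steps with vanishing frequency only, the adversary has
received nothing for `m (t + 1)` steps with a frequency that is bounded below by a multiple of
`(λ (1 - λ_e)) ^ m`. -/
lemma eventually_le_average_etaEGe {pol : Policy} {init : PMF HoldingTimes}
    (hA : (ch.lamA : ℝ) = 1) (hl : 0 < (ch.lam : ℝ)) (hE : (ch.lamE : ℝ) < 1) {t m : ℕ}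
    (hm : 0 < m)
    (hrep : Tendsto (fun T : ℕ => (∑ k ∈ Finset.range T,
      expect (stateLaw ch pol init k) (repeatProb ch pol t)) / (T : ℝ≥0∞)) atTop (𝓝 0)) :
    ∀ᶠ T : ℕ in atTop, ENNReal.ofReal (ch.lam * (1 - ch.lamE)) ^ m / 2 ≤
      (∑ k ∈ Finset.Icc 1 T,
        expect (stateLaw ch pol init k) (etaEGe (m * (t + 1)))) / (T : ℝ≥0∞) := by
  set l := ENNReal.ofReal ch.lam with hl'
  set q := ENNReal.ofReal (ch.lam * (1 - ch.lamE)) with hq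
  have hqe : l * ENNReal.ofReal (1 - ch.lamE) = q := (ENNReal.ofReal_mul hl.le).symm
  have hq0 : q ≠ 0 := (ENNReal.ofReal_pos.2 (mul_pos hl (by linarith))).ne'
  have hl0 : l ≠ 0 := (ENNReal.ofReal_pos.2 hl).ne'
  have hlt : l ≠ ⊤ := ENNReal.ofReal_ne_top
  set x : ℕ → ℝ≥0∞ := fun k => expect (stateLaw ch pol init (k + 1)) (etaEGe (m * (t + 1)))
  obtain ⟨L, hL⟩ : ∃ L, m * (t + 1) = L + 1 :=
    ⟨m * (t + 1) - 1, (Nat.sub_add_cancel (Nat.mul_pos hm (Nat.succ_pos t))).symm⟩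
  have key : ∀ k, l * q ^ m ≤ l * x (k + L) + ∑ i ∈ Finset.range (L + 1),
      expect (stateLaw ch pol init (k + i)) (repeatProb ch pol t) := by
    intro k
    have h := expect_mono (p := stateLaw ch pol init k) fun s =>
      survival_le (pol := pol) hA t (L + 1) 0 m 0 s (by omega) (Nat.zero_le _)
    rw [expect_const, ← hl', hqe] at h
    simp only [hitProb, zero_add] at h
    rw [expect_add, expect_const_mul, ← expect_stateLaw_add, expect_repeatSum, ← add_assoc k,
      ← hL] at h
    rwa [← hL]
  have hev := eventually_half_le_average (x := x) (l := l)
    (fun k => expect_le_one (etaEGe_le_one _)) (fun k => expect_le_one (repeatProb_le_one ch pol t))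
    (mul_ne_zero hl0 (pow_ne_zero m hq0))
    (ENNReal.mul_ne_top hlt (ENNReal.pow_ne_top ENNReal.ofReal_ne_top))
    (ofReal_unitInterval_le_one _) L (L + 1) key hrep
  filter_upwards [hev] with T hT
  have e : ∑ k ∈ Finset.Icc 1 T, expect (stateLaw ch pol init k) (etaEGe (m * (t + 1))) =
      ∑ k ∈ Finset.range T, x k := by
    rw [← Finset.Ico_add_one_right_eq_Icc, Finset.sum_Ico_eq_sum_range]
    simp only [Nat.add_sub_cancel, add_comm 1, x]
  rw [e]
  rw [mul_div_assoc] at hT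
  exact (ENNReal.mul_le_mul_iff_right hl0 hlt).1 hT

lemma liminf_avgErr_etaE_eq_top {n : ℕ} {A Q Pbar : Matrix (Fin n) (Fin n) ℝ} {pol : Policy}
    {init : PMF HoldingTimes} {ρ c : ℝ} (hρ : 1 ≤ ρ) (hc0 : 0 < c)
    (hc : ∀ h, 0 < h → c * ρ ^ h ≤ errTrace A Q Pbar h)
    (hA : (ch.lamA : ℝ) = 1) (hl : 0 < (ch.lam : ℝ)) (hE : (ch.lamE : ℝ) < 1) {t : ℕ}
    (ht : 1 < ρ ^ (t + 1) * (ch.lam * (1 - ch.lamE)))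
    (hrep : Tendsto (fun T : ℕ => (∑ k ∈ Finset.range T,
      expect (stateLaw ch pol init k) (repeatProb ch pol t)) / (T : ℝ≥0∞)) atTop (𝓝 0)) :
    liminf (avgErr A Q Pbar ch pol init HoldingTimes.etaE) atTop = ⊤ := by
  set q : ℝ := ch.lam * (1 - ch.lamE) with hq
  have hq0 : 0 < q := mul_pos hl (by linarith)
  have hlow : ∀ m : ℕ, 0 < m → ENNReal.ofReal (c / 2 * (ρ ^ (t + 1) * q) ^ m) ≤
      liminf (avgErr A Q Pbar ch pol init HoldingTimes.etaE) atTop := by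
    intro m hm
    refine le_liminf_of_le (by isBoundedDefault) ?_
    filter_upwards [eventually_le_average_etaEGe hA hl hE hm hrep] with T hT
    have hpt : ∀ s : HoldingTimes, ENNReal.ofReal (c * ρ ^ (m * (t + 1))) *
        etaEGe (m * (t + 1)) s ≤ ENNReal.ofReal (errTrace A Q Pbar s.etaE) := by
      intro s
      unfold etaEGe
      split
      · rename_i hs
        rw [mul_one]
        have hpos : 0 < m * (t + 1) := Nat.mul_pos hm (Nat.succ_pos t)
        refine ENNReal.ofReal_le_ofReal (le_trans ?_ (hc _ (hpos.trans_le hs)))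
        gcongr
      · simp
    have e : ENNReal.ofReal (c / 2 * (ρ ^ (t + 1) * q) ^ m) =
        ENNReal.ofReal (c * ρ ^ (m * (t + 1))) * (ENNReal.ofReal q ^ m / 2) := by
      have h2 : ENNReal.ofReal q ^ m / 2 = ENNReal.ofReal (q ^ m / 2) := by
        rw [ENNReal.ofReal_div_of_pos two_pos, ENNReal.ofReal_pow hq0.le]; simp
      rw [h2, ← ENNReal.ofReal_mul (by positivity), mul_pow, ← pow_mul, mul_comm m]
      congr 1
      ring
    rw [e]
    calc _ ≤ ENNReal.ofReal (c * ρ ^ (m * (t + 1))) * ((∑ k ∈ Finset.Icc 1 T,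
          expect (stateLaw ch pol init k) (etaEGe (m * (t + 1)))) / (T : ℝ≥0∞)) := by gcongr
      _ ≤ _ := by
        rw [← mul_div_assoc, Finset.mul_sum, avgErr]
        gcongr with k
        rw [← expect_const_mul]
        exact expect_mono hpt
  have htend : Tendsto (fun m : ℕ => ENNReal.ofReal (c / 2 * (ρ ^ (t + 1) * q) ^ m)) atTop
      (𝓝 ⊤) :=
    ENNReal.tendsto_ofReal_atTop.comp
      ((tendsto_pow_atTop_atTop_of_one_lt ht).const_mul_atTop (by positivity))
  exact top_le_iff.1 (le_of_tendsto htend ((eventually_gt_atTop 0).mono hlow))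

end Secrecy

/-! ### Bounded errors at the legitimate estimator -/

section Stability

/-- The discounted sum `∑ₖ r⁻ᵏ e(h + k)` of the values of `e` from `h` on. -/
def discountedSum (r : ℝ≥0∞) (e : ℕ → ℝ≥0∞) (h : ℕ) : ℝ≥0∞ := ∑' k, r⁻¹ ^ k * e (h + k)

lemma le_discountedSum (r : ℝ≥0∞) (e : ℕ → ℝ≥0∞) (h : ℕ) : e h ≤ discountedSum r e h := by
  simpa [discountedSum] using ENNReal.le_tsum (f := fun k => r⁻¹ ^ k * e (h + k)) 0

lemma discountedSum_succ_le {r : ℝ≥0∞} (h0 : r ≠ 0) (ht : r ≠ ⊤) (e : ℕ → ℝ≥0∞) (h : ℕ) :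
    discountedSum r e (h + 1) ≤ r * discountedSum r e h := by
  have e1 : discountedSum r e h = e h + r⁻¹ * discountedSum r e (h + 1) := by
    rw [discountedSum, tsum_eq_zero_add' ENNReal.summable, discountedSum, ← ENNReal.tsum_mul_left]
    simp only [pow_zero, one_mul, add_zero, pow_succ', mul_assoc, add_assoc, add_comm 1]
  rw [e1, mul_add, ← mul_assoc, ENNReal.mul_inv_cancel h0 ht, one_mul]
  exact le_add_self

lemma exists_discountedSum_le {e : ℕ → ℝ≥0∞} {c r r' : ℝ} (h0 : 0 < r') (hr : r' < r)
    (he : ∀ h k, e (h + k) ≤ ENNReal.ofReal (c * r' ^ k) * (e h + 1)) :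
    ∃ d : ℝ≥0∞, d ≠ ⊤ ∧ ∀ h, discountedSum (ENNReal.ofReal r) e h ≤ d * (e h + 1) := by
  have hr0 : 0 < r := h0.trans hr
  refine ⟨∑' k : ℕ, ENNReal.ofReal c * ENNReal.ofReal (r' / r) ^ k, ?_, fun h => ?_⟩
  · rw [ENNReal.tsum_mul_left, ENNReal.tsum_geometric]
    refine ENNReal.mul_ne_top ENNReal.ofReal_ne_top (ENNReal.inv_ne_top.2 ?_)
    refine (tsub_pos_of_lt ?_).ne'
    rw [ENNReal.ofReal_lt_one]
    exact (div_lt_one hr0).2 hr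
  · rw [discountedSum, ← ENNReal.tsum_mul_right]
    refine ENNReal.tsum_le_tsum fun k => ?_
    calc (ENNReal.ofReal r)⁻¹ ^ k * e (h + k)
        ≤ (ENNReal.ofReal r)⁻¹ ^ k * (ENNReal.ofReal (c * r' ^ k) * (e h + 1)) := by
          gcongr; exact he h k
      _ = _ := by
          rw [mul_comm c, ENNReal.ofReal_mul (by positivity), ENNReal.ofReal_pow h0.le,
            div_eq_mul_inv, ENNReal.ofReal_mul h0.le, ENNReal.ofReal_inv_of_pos hr0, mul_pow]
          ring

variable {ch : Channel}

/-- A Lyapunov function for the chain under the threshold policy. The factor `κ ^ (t + 1 - η^s)`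
pays in advance for the growth of the error while the sensor is silent (the exponent is truncated
at `0`). -/
def lyapunov (κ r : ℝ≥0∞) (e : ℕ → ℝ≥0∞) (t : ℕ) (s : HoldingTimes) : ℝ≥0∞ :=
  κ ^ (t + 1 - s.etaS) * discountedSum r e s.eta

/-- The drift condition: one step contracts the Lyapunov function by the factor `θ`, up to a
constant that accounts for receptions. -/
lemma transit_lyapunov_le (hA : (ch.lamA : ℝ) = 1) {κ r θ : ℝ≥0∞} {t : ℕ} (h0 : r ≠ 0)
    (ht : r ≠ ⊤) (hκ : r = θ * κ) (hθ : ENNReal.ofReal (1 - ch.lam) * r ≤ θ) (e : ℕ → ℝ≥0∞)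
    (s : HoldingTimes) :
    transit ch (thresholdPolicy t) (lyapunov κ r e t) s ≤
      θ * lyapunov κ r e t s + κ ^ (t + 1) * discountedSum r e 0 := by
  have hE := ofReal_add_ofReal_one_sub ch.lamE
  have hs := discountedSum_succ_le h0 ht e s.eta
  rw [transit, expect_step hA]
  by_cases hts : t < s.etaS
  · have i1 : t + 1 - s.etaS = 0 := by omega
    have i2 : t - s.etaS = 0 := by omega
    simp only [thresholdPolicy, hts, if_true, lyapunov, Nat.add_sub_add_right, i1, i2, pow_zero,
      one_mul, tsub_zero, ← add_mul, hE, Set.Icc.coe_one, ENNReal.ofReal_one, sub_self,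
      ENNReal.ofReal_zero, zero_mul, add_zero]
    rw [add_comm]
    refine add_le_add ?_ ?_
    · calc _ ≤ ENNReal.ofReal (1 - ch.lam) * (r * discountedSum r e s.eta) := by gcongr
        _ = ENNReal.ofReal (1 - ch.lam) * r * discountedSum r e s.eta := by ring
        _ ≤ _ := mul_le_mul_left hθ _
    · exact mul_le_of_le_one_left' (ofReal_unitInterval_le_one _)
  · obtain ⟨j, hj⟩ : ∃ j, t + 1 - s.etaS = j + 1 := ⟨t - s.etaS, by omega⟩
    have i2 : t - s.etaS = j := by omega
    simp only [thresholdPolicy, hts, if_false, lyapunov, Nat.add_sub_add_right, hj, i2,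
      Set.Icc.coe_zero, ENNReal.ofReal_zero, zero_mul, zero_add, sub_zero,
      ENNReal.ofReal_one, one_mul]
    refine le_add_right ?_
    calc κ ^ j * discountedSum r e (s.eta + 1)
        ≤ κ ^ j * (r * discountedSum r e s.eta) := by gcongr
      _ = θ * (κ ^ (j + 1) * discountedSum r e s.eta) := by rw [hκ]; ring

/-- A drift condition with a factor `θ < 1` bounds the expectations of the Lyapunov function
uniformly in time. -/
lemma expect_stateLaw_le_of_drift {pol : Policy} {init : PMF HoldingTimes}
    {V : HoldingTimes → ℝ≥0∞} {θ : ℝ} {b : ℝ≥0∞} (hθ0 : 0 ≤ θ) (hθ1 : θ < 1)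
    (hV : ∀ s, transit ch pol V s ≤ ENNReal.ofReal θ * V s + b) (k : ℕ) :
    expect (stateLaw ch pol init k) V ≤ expect init V + ENNReal.ofReal (1 / (1 - θ)) * b := by
  have h1 : 0 < 1 - θ := by linarith
  induction k with
  | zero => exact le_self_add
  | succ k ih =>
    rw [expect_stateLaw_succ]
    have hle : ENNReal.ofReal θ ≤ 1 := ENNReal.ofReal_le_one.2 hθ1.le
    have hb : ENNReal.ofReal θ * (ENNReal.ofReal (1 / (1 - θ)) * b) + b =
        ENNReal.ofReal (1 / (1 - θ)) * b := by
      rw [← mul_assoc, ← ENNReal.ofReal_mul hθ0]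
      nth_rewrite 2 [← one_mul b]
      rw [← add_mul, ← ENNReal.ofReal_one, ← ENNReal.ofReal_add (by positivity) zero_le_one]
      congr 2
      field_simp
      ring
    calc expect (stateLaw ch pol init k) (transit ch pol V)
        ≤ expect (stateLaw ch pol init k) (fun s => ENNReal.ofReal θ * V s + b) := expect_mono hV
      _ = ENNReal.ofReal θ * expect (stateLaw ch pol init k) V + b := by
          rw [expect_add, expect_const_mul, expect_const]
      _ ≤ ENNReal.ofReal θ * (expect init V + ENNReal.ofReal (1 / (1 - θ)) * b) + b := by gcongr
      _ = ENNReal.ofReal θ * expect init V +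
            (ENNReal.ofReal θ * (ENNReal.ofReal (1 / (1 - θ)) * b) + b) := by ring
      _ ≤ _ := by rw [hb]; gcongr; exact mul_le_of_le_one_left' hle

lemma limsup_avgErr_eta_lt_top {n : ℕ} {A Q Pbar : Matrix (Fin n) (Fin n) ℝ} (hQ : Q.PosSemidef)
    (hP : Pbar.PosSemidef) (hmax : 1 < maxEig A) (hA : (ch.lamA : ℝ) = 1) (t : ℕ)
    (hlam : 1 - 1 / maxEig A ^ 2 < (ch.lam : ℝ)) {init : PMF HoldingTimes}
    (hinit : (∑' s, init s * ENNReal.ofReal (errTrace A Q Pbar s.eta)) < ⊤) :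
    limsup (avgErr A Q Pbar ch (thresholdPolicy t) init HoldingTimes.eta) atTop < ⊤ := by
  have hρ : 1 < maxEig A ^ 2 := one_lt_pow₀ hmax two_ne_zero
  have hl1 : 0 ≤ 1 - (ch.lam : ℝ) := sub_nonneg.2 ch.lam.2.2
  have hstab : (1 - (ch.lam : ℝ)) * maxEig A ^ 2 < 1 := by
    rw [← lt_div_iff₀ (by linarith)]
    linarith
  obtain ⟨r, hr, hlr⟩ : ∃ r, maxEig A ^ 2 < r ∧ (1 - (ch.lam : ℝ)) * r < 1 := by
    have hc : Tendsto (fun r : ℝ => (1 - (ch.lam : ℝ)) * r) (𝓝[>] (maxEig A ^ 2))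
        (𝓝 ((1 - (ch.lam : ℝ)) * maxEig A ^ 2)) :=
      ((continuous_const.mul continuous_id).tendsto _).mono_left nhdsWithin_le_nhds
    exact ((eventually_mem_nhdsWithin).and (hc.eventually (gt_mem_nhds hstab))).exists
  obtain ⟨r', hr', hrr⟩ := exists_between hr
  have hr1 : 1 < r := hρ.trans hr
  -- The maximum with `1 / 2` keeps `θ` positive when `λ = 1`.
  set θ : ℝ := max ((1 - (ch.lam : ℝ)) * r) (1 / 2) with hθ
  have hθ0 : 0 < θ := lt_of_lt_of_le one_half_pos (le_max_right _ _)
  have hθ1 : θ < 1 := max_lt hlr one_half_lt_one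
  obtain ⟨c, hc0, hc⟩ := exists_errTrace_le (A := A) hQ hP (hρ.trans hr') hr'
  set e : ℕ → ℝ≥0∞ := fun h => ENNReal.ofReal (errTrace A Q Pbar h) with he
  have hr'0 : 0 < r' := by linarith
  obtain ⟨d, hd, hde⟩ := exists_discountedSum_le (e := e) (c := c) hr'0 hrr fun h k => by
    have hnn := errTrace_nonneg (A := A) hQ hP h
    rw [he, ← ENNReal.ofReal_one, ← ENNReal.ofReal_add hnn zero_le_one,
      ← ENNReal.ofReal_mul (by positivity)]
    exact ENNReal.ofReal_le_ofReal (hc h k)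
  set κ : ℝ≥0∞ := ENNReal.ofReal (r / θ) with hκ
  have hκ1 : 1 ≤ κ := by
    rw [hκ, ← ENNReal.ofReal_one]
    exact ENNReal.ofReal_le_ofReal ((one_le_div hθ0).2 (by linarith))
  have hκt : κ ≠ ⊤ := ENNReal.ofReal_ne_top
  have hdrift := transit_lyapunov_le (ch := ch) hA (κ := κ) (r := ENNReal.ofReal r)
    (θ := ENNReal.ofReal θ) (t := t) (ENNReal.ofReal_pos.2 (by linarith)).ne'
    ENNReal.ofReal_ne_top
    (by rw [hκ, ← ENNReal.ofReal_mul hθ0.le, mul_div_cancel₀ r hθ0.ne'])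
    (by rw [← ENNReal.ofReal_mul hl1]; exact ENNReal.ofReal_le_ofReal (le_max_left _ _)) e
  have hbound := expect_stateLaw_le_of_drift (init := init) hθ0.le hθ1 hdrift
  set M := expect init (lyapunov κ (ENNReal.ofReal r) e t) +
    ENNReal.ofReal (1 / (1 - θ)) * (κ ^ (t + 1) * discountedSum (ENNReal.ofReal r) e 0) with hM
  have hVinit : expect init (lyapunov κ (ENNReal.ofReal r) e t) < ⊤ := by
    calc _ ≤ expect init (fun s => κ ^ (t + 1) * (d * (e s.eta + 1))) := by
          refine expect_mono fun s => ?_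
          exact mul_le_mul' (pow_le_pow_right₀ hκ1 (Nat.sub_le _ _)) (hde _)
      _ = κ ^ (t + 1) * (d * (expect init (fun s => e s.eta) + 1)) := by
          rw [expect_const_mul, expect_const_mul, expect_add, expect_const]
      _ < ⊤ := ENNReal.mul_lt_top (ENNReal.pow_lt_top hκt.lt_top)
          (ENNReal.mul_lt_top hd.lt_top (ENNReal.add_lt_top.2 ⟨hinit, ENNReal.one_lt_top⟩))
  have hM : M < ⊤ := by
    refine ENNReal.add_lt_top.2 ⟨hVinit, ENNReal.mul_lt_top ENNReal.ofReal_lt_top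
      (ENNReal.mul_lt_top (ENNReal.pow_lt_top hκt.lt_top) ((hde 0).trans_lt ?_))⟩
    exact ENNReal.mul_lt_top hd.lt_top
      (ENNReal.add_lt_top.2 ⟨ENNReal.ofReal_lt_top, ENNReal.one_lt_top⟩)
  have heV : ∀ s : HoldingTimes, e s.eta ≤ lyapunov κ (ENNReal.ofReal r) e t s := fun s =>
    (le_discountedSum _ e _).trans (le_mul_of_one_le_left' (one_le_pow₀ hκ1))
  refine lt_of_le_of_lt (limsup_le_of_le (by isBoundedDefault) (Eventually.of_forall ?_)) hM
  intro T
  refine ENNReal.div_le_of_le_mul ?_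
  calc _ ≤ ∑ _k ∈ Finset.Icc 1 T, M :=
        Finset.sum_le_sum fun k _ => (expect_mono heV).trans (hbound k)
    _ = M * T := by simp [mul_comm]

end Stability

end RemoteEstimation

end

/-- Part one: with the threshold reference policy, no malicious policy has a bounded averaged
expected error covariance `J_e` at the adversary (even along a subsequence of horizons) and meets
the stealthy constraint. Part two: without an intrusion `J_l` is bounded when
`λ > 1 - 1/|λ_max(A)|²`, so that perfect secrecy is attained. -/
theorem mainTheorem1 {n p : ℕ}
    (A : Matrix (Fin n) (Fin n) ℝ) (C : Matrix (Fin p) (Fin n) ℝ)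
    (Q sqrtQ : Matrix (Fin n) (Fin n) ℝ) (R : Matrix (Fin p) (Fin p) ℝ)
    (hsqrtQ : sqrtQ.PosSemidef) (hQ : Q = sqrtQ * sqrtQ) (hR : R.PosSemidef)
    (hobs : RemoteEstimation.Observable C A) (hctrl : RemoteEstimation.Controllable A sqrtQ)
    (Pbar : Matrix (Fin n) (Fin n) ℝ)
    (hPbar : RemoteEstimation.IsSteadyStateCov A C Q R Pbar)
    (ch : RemoteEstimation.Channel)
    (hlamA : (ch.lamA : ℝ) = 1) (hlamE0 : 0 < (ch.lamE : ℝ)) (hlamE1 : (ch.lamE : ℝ) < 1)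
    (hA : 1 < RemoteEstimation.maxEig A)
    (t : ℕ)
    (ht : 1 / RemoteEstimation.maxEig A ^ (2 * (t + 1)) < (ch.lam : ℝ) * (1 - (ch.lamE : ℝ))) :
    (∀ (N : ℕ) (_hN : t < N) (ε : ℝ) (_hε : 0 < ε)
        (init₀ : PMF RemoteEstimation.HoldingTimes) (P₀ : PMF (Fin N → Bool))
        (_hP₀ : RemoteEstimation.IsLongRunObsLaw ch
          (RemoteEstimation.thresholdPolicy t) init₀ N P₀),
      ¬ ∃ (pol : RemoteEstimation.Policy) (init : PMF RemoteEstimation.HoldingTimes)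
          (P₁ : PMF (Fin N → Bool)),
        RemoteEstimation.IsLongRunObsLaw ch pol init N P₁ ∧
        InformationTheory.klDiv P₁.toMeasure P₀.toMeasure ≤ ENNReal.ofReal ε ∧
        liminf (RemoteEstimation.avgErr A Q Pbar ch pol init
          RemoteEstimation.HoldingTimes.etaE) atTop < ⊤) ∧
    (1 - 1 / RemoteEstimation.maxEig A ^ 2 < (ch.lam : ℝ) →
      ∀ init : PMF RemoteEstimation.HoldingTimes,
        (∑' s, init s * ENNReal.ofReal (RemoteEstimation.errTrace A Q Pbar s.eta)) < ⊤ →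
        limsup (RemoteEstimation.avgErr A Q Pbar ch (RemoteEstimation.thresholdPolicy t) init
          RemoteEstimation.HoldingTimes.eta) atTop < ⊤) := by
  have hQpsd : Q.PosSemidef := by
    rw [hQ]
    nth_rewrite 1 [← hsqrtQ.isHermitian.eq]
    exact Matrix.posSemidef_conjTranspose_mul_self sqrtQ
  have hP := hPbar.posSemidef hQpsd hR
  refine ⟨?_, fun hlam init hinit =>
    RemoteEstimation.limsup_avgErr_eta_lt_top hQpsd hP hA hlamA t hlam hinit⟩
  rintro N hN ε - init₀ P₀ hP₀ ⟨pol, init, P₁, hP₁, hkl, hJ⟩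
  have hE : 0 < 1 - (ch.lamE : ℝ) := by linarith
  have hρ : 0 < RemoteEstimation.maxEig A := by linarith
  have hq : 0 < (ch.lam : ℝ) * (1 - (ch.lamE : ℝ)) := lt_trans (by positivity) ht
  have hl : 0 < (ch.lam : ℝ) := pos_of_mul_pos_left hq hE.le
  have hrep := RemoteEstimation.tendsto_average_repeatProb hN hP₁ fun w hw =>
    RemoteEstimation.apply_eq_zero_of_klDiv_ne_top (hkl.trans_lt ENNReal.ofReal_lt_top).ne
      (hP₀.apply_eq_zero_of_threshold hlamA hN hw)
  subst hQ
  obtain ⟨c, hc0, hc⟩ := RemoteEstimation.exists_le_errTrace hsqrtQ hctrl hA hP hQpsd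
  refine hJ.ne (RemoteEstimation.liminf_avgErr_etaE_eq_top (one_le_pow₀ hA.le) hc0 hc hlamA hl
    hlamE1 (t := t) ?_ hrep)
  rwa [div_lt_iff₀ (by positivity), mul_comm, pow_mul] at ht
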